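/- Let $\zeta$ denote the Riemann zeta function, meromorphically continued to $\mathbb{C}$ with its only pole, a simple one, at $s=1$. Then $\zeta$ has no zeros in the region $$\{\, s\in\mathbb{C} : |s-1|\le 2.2093,\ 0\le \operatorname{Re}(s)\le 1 \,\}.$$ -/

import Mathlib

/-!
For `a > 0` let `T a s` be `trapezoidError a s`, that is,
`(s - 1) (a ^ (-s) + (a + 1) ^ (-s)) / 2 + (a + 1) ^ (1 - s) - a ^ (1 - s)`,
which is `s - 1` times the error of the trapezoidal rule for `∫ x in a..a + 1, x ^ (-s)`. It equals
`(s - 1) s (s + 1) / 2 * ∫ x in a..a + 1, (x - a) (a + 1 - x) x ^ (-s - 2)`, so with `σ = re s > -1`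
and `(x - a) (a + 1 - x) ≤ 1 / 4`,
`‖T a s‖ ≤ ‖s - 1‖ ‖s‖ ‖s + 1‖ / (8 (σ + 1)) * (a ^ (-σ - 1) - (a + 1) ^ (-σ - 1))`
(`norm_trapezoidError_le`). Summing over `a = 1, 2, …` the right side telescopes.

For `1 < σ` the sum of `T n s` over `n ≥ 1` is `(s - 1) ζ(s) - (s + 1) / 2`, and by analytic
continuation this holds for `0 < σ` (`riemannZeta₁_eq_add_tsum`). At a zero `s ≠ 1` of `ζ`
therefore `‖s + 1‖ / 2 ≤ ‖s - 1‖ ‖s‖ ‖s + 1‖ / (8 (σ + 1))`, that is, `4 (σ + 1) ≤ ‖s‖ ‖s - 1‖`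
(`four_mul_re_add_one_le_of_riemannZeta_eq_zero`). For `1 / 2 ≤ σ ≤ 1` the left side is at least
`6`, while in the region considered the right side is less than `6`. Zeros with `σ < 1 / 2` are
carried to `1 - s` by the functional equation; the same estimate excludes them.
-/

open Complex Filter Topology Set

/-! ### The error of the trapezoidal rule -/

/-- `s - 1` times the error of the trapezoidal rule for the integral of `x ^ (-s)` over
`[a, a + 1]`. The factor `s - 1` makes it an entire function of `s`. -/
noncomputable def trapezoidError (a : ℝ) (s : ℂ) : ℂ :=
  (s - 1) * (((a : ℂ) ^ (-s) + ((a + 1 : ℝ) : ℂ) ^ (-s)) / 2)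
    + (((a + 1 : ℝ) : ℂ) ^ (1 - s) - (a : ℂ) ^ (1 - s))

theorem differentiable_trapezoidError {a : ℝ} (ha : 0 < a) :
    Differentiable ℂ (trapezoidError a) := by
  have h0 : (a : ℂ) ≠ 0 := by exact_mod_cast ha.ne'
  have h1 : ((a + 1 : ℝ) : ℂ) ≠ 0 := by exact_mod_cast (by positivity : a + 1 ≠ 0)
  have key : ∀ {c : ℂ}, c ≠ 0 → ∀ {f : ℂ → ℂ}, Differentiable ℂ f →
      Differentiable ℂ fun s => c ^ f s :=
    fun hc f hf s => (hf s).const_cpow (Or.inl hc)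
  unfold trapezoidError
  have d0 := key h0 (f := fun s => -s) (by fun_prop)
  have d1 := key h1 (f := fun s => -s) (by fun_prop)
  have d2 := key h0 (f := fun s => 1 - s) (by fun_prop)
  have d3 := key h1 (f := fun s => 1 - s) (by fun_prop)
  fun_prop

/-- A primitive of `x ↦ (s - 1) s (s + 1) (x - a) (a + 1 - x) x ^ (-s - 2)`; its increment over
`[a, a + 1]` is `2 * trapezoidError a s`. -/
noncomputable def trapezoidPrimitive (a : ℝ) (s : ℂ) (x : ℝ) : ℂ :=
  ((s - 1) * (-s * ((x - a) * (a + 1 - x)) - (2 * a + 1 - 2 * x) * x) + 2 * x ^ 2)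
    * (x : ℂ) ^ (-s - 1)

theorem hasDerivAt_trapezoidPrimitive (a : ℝ) {s : ℂ} (hs : -1 < s.re) {x : ℝ} (hx : 0 < x) :
    HasDerivAt (trapezoidPrimitive a s)
      ((s - 1) * s * (s + 1) * ((x - a) * (a + 1 - x)) * (x : ℂ) ^ (-s - 2)) x := by
  have hx0 : (x : ℂ) ≠ 0 := by exact_mod_cast hx.ne'
  have hs1 : -s - 1 ≠ 0 := by
    intro h
    have := congrArg Complex.re h
    simp at this
    linarith
  have hf := hasDerivAt_ofReal_cpow_const hx.ne' hs1
  have hid : HasDerivAt (fun y : ℝ => (y : ℂ)) 1 x := Complex.ofRealCLM.hasDerivAt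
  have hq := (((((hid.sub_const (a : ℂ)).mul (hid.const_sub ((a : ℂ) + 1))).const_mul (-s)).sub
    (((hid.const_mul (2 : ℂ)).const_sub (2 * (a : ℂ) + 1)).mul hid)).const_mul (s - 1)).add
    ((hid.pow 2).const_mul (2 : ℂ))
  have e1 : (x : ℂ) ^ (-s - 1) = x * (x : ℂ) ^ (-s - 2) := by
    rw [show -s - 1 = 1 + (-s - 2) by ring, cpow_add _ _ hx0, cpow_one]
  have e2 : -s - 1 - 1 = -s - 2 := by ring
  refine (hq.mul hf).congr_deriv ?_
  rw [e2, e1]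
  simp
  ring

theorem trapezoidPrimitive_sub {a : ℝ} (ha : 0 < a) (s : ℂ) :
    trapezoidPrimitive a s (a + 1) - trapezoidPrimitive a s a = 2 * trapezoidError a s := by
  have key : ∀ {x : ℝ}, 0 < x → (x : ℂ) ^ (-s) = x * (x : ℂ) ^ (-s - 1) ∧
      (x : ℂ) ^ (1 - s) = x ^ 2 * (x : ℂ) ^ (-s - 1) := by
    intro x hx
    have hx0 : (x : ℂ) ≠ 0 := by exact_mod_cast hx.ne'
    constructor
    · rw [show -s = 1 + (-s - 1) by ring, cpow_add _ _ hx0, cpow_one]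
      ring_nf
    · rw [show 1 - s = 1 + (1 + (-s - 1)) by ring, cpow_add _ _ hx0, cpow_add _ _ hx0, cpow_one]
      ring
  have h1 := key ha
  have h2 := key (show 0 < a + 1 by positivity)
  unfold trapezoidPrimitive trapezoidError
  rw [h1.1, h1.2, h2.1, h2.2]
  push_cast
  ring

theorem norm_deriv_trapezoidPrimitive_le {a : ℝ} (ha : 0 < a) (s : ℂ) {x : ℝ}
    (hx : x ∈ Ico a (a + 1)) :
    ‖(s - 1) * s * (s + 1) * ((x - a) * (a + 1 - x)) * (x : ℂ) ^ (-s - 2)‖ ≤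
      ‖s - 1‖ * ‖s‖ * ‖s + 1‖ / 4 * x ^ (-s.re - 2) := by
  have hx0 : 0 < x := ha.trans_le hx.1
  have hq : ‖((x - a) * (a + 1 - x) : ℂ)‖ ≤ 1 / 4 := by
    rw [show ((x - a) * (a + 1 - x) : ℂ) = (((x - a) * (a + 1 - x) : ℝ) : ℂ) by push_cast; ring,
      norm_real, Real.norm_of_nonneg (mul_nonneg (sub_nonneg.2 hx.1) (sub_nonneg.2 hx.2.le))]
    nlinarith [sq_nonneg (x - a - 1 / 2)]
  rw [norm_mul, norm_mul, norm_mul, norm_mul, norm_cpow_eq_rpow_re_of_pos hx0]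
  have : (-s - 2).re = -s.re - 2 := by simp
  rw [this]
  have := Real.rpow_nonneg hx0.le (-s.re - 2)
  calc _ ≤ ‖s - 1‖ * ‖s‖ * ‖s + 1‖ * (1 / 4) * x ^ (-s.re - 2) := by gcongr
    _ = _ := by ring

theorem norm_trapezoidError_le {a : ℝ} (ha : 0 < a) {s : ℂ} (hs : -1 < s.re) :
    ‖trapezoidError a s‖ ≤ ‖s - 1‖ * ‖s‖ * ‖s + 1‖ / (8 * (s.re + 1)) *
      (a ^ (-s.re - 1) - (a + 1) ^ (-s.re - 1)) := by
  set C := ‖s - 1‖ * ‖s‖ * ‖s + 1‖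
  have hσ : s.re + 1 ≠ 0 := by linarith
  have hB : ∀ x ∈ Icc a (a + 1),
      HasDerivAt (fun x : ℝ => C / 4 / (s.re + 1) * (a ^ (-s.re - 1) - x ^ (-s.re - 1)))
        (C / 4 * x ^ (-s.re - 2)) x := by
    intro x hx
    have h := ((Real.hasDerivAt_rpow_const (p := -s.re - 1)
      (Or.inl (ha.trans_le hx.1).ne')).const_sub (a ^ (-s.re - 1))).const_mul (C / 4 / (s.re + 1))
    refine h.congr_deriv ?_
    rw [show -s.re - 1 - 1 = -s.re - 2 by ring]
    field_simp
    ring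
  have hG : ∀ x ∈ Icc a (a + 1), HasDerivAt
      (fun x => trapezoidPrimitive a s x - trapezoidPrimitive a s a) _ x :=
    fun x hx => (hasDerivAt_trapezoidPrimitive a hs (ha.trans_le hx.1)).sub_const _
  have h := image_norm_le_of_norm_deriv_right_le_deriv_boundary'
    (fun x hx => (hG x hx).continuousAt.continuousWithinAt)
    (fun x hx => (hG x (Ico_subset_Icc_self hx)).hasDerivWithinAt)
    (by simp) (fun x hx => (hB x hx).continuousAt.continuousWithinAt)
    (fun x hx => (hB x (Ico_subset_Icc_self hx)).hasDerivWithinAt)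
    (fun x hx => norm_deriv_trapezoidPrimitive_le ha s hx)
    (right_mem_Icc.2 (by linarith))
  rw [trapezoidPrimitive_sub ha, norm_mul, Complex.norm_ofNat] at h
  have e : C / (8 * (s.re + 1)) = C / 4 / (s.re + 1) / 2 := by field_simp; ring
  rw [e]
  linarith

/-- Unlike `norm_trapezoidError_le`, this is a bound that is uniform in `s` on bounded subsets of
the right half-plane. -/
theorem norm_trapezoidError_le_sq {a : ℝ} (ha : 1 ≤ a) {s : ℂ} (hs : 0 < s.re) :
    ‖trapezoidError a s‖ ≤ ‖s - 1‖ * ‖s‖ * ‖s + 1‖ / 8 * (1 / a ^ 2) := by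
  have ha0 : 0 < a := by linarith
  have h := norm_image_sub_le_of_norm_deriv_le_segment'
    (f := trapezoidPrimitive a s) (a := a) (b := a + 1)
    (C := ‖s - 1‖ * ‖s‖ * ‖s + 1‖ / 4 * (1 / a ^ 2))
    (fun x hx => (hasDerivAt_trapezoidPrimitive a (by linarith)
      (ha0.trans_le hx.1)).hasDerivWithinAt)
    (fun x hx => (norm_deriv_trapezoidPrimitive_le ha0 s hx).trans ?_)
    (a + 1) (right_mem_Icc.2 (by linarith))
  · rw [trapezoidPrimitive_sub ha0, norm_mul, Complex.norm_ofNat] at h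
    linarith
  · gcongr
    calc x ^ (-s.re - 2) ≤ x ^ (-2 : ℝ) :=
          Real.rpow_le_rpow_of_exponent_le (ha.trans hx.1) (by linarith)
      _ = 1 / x ^ 2 := by
          rw [Real.rpow_neg (by linarith [hx.1]), one_div]
          norm_cast
      _ ≤ 1 / a ^ 2 := by gcongr; exact hx.1

/-! ### Summation over the positive integers -/

theorem summable_one_div_nat_add_one_sq : Summable fun n : ℕ => 1 / ((n : ℝ) + 1) ^ 2 := by
  simpa using (summable_nat_add_iff 1).2 (Real.summable_one_div_nat_pow.2 one_lt_two)

theorem summable_trapezoidError {s : ℂ} (hs : 0 < s.re) :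
    Summable fun n : ℕ => trapezoidError (n + 1) s :=
  .of_norm_bounded (summable_one_div_nat_add_one_sq.mul_left _)
    fun n => norm_trapezoidError_le_sq (by simp) hs

theorem norm_tsum_trapezoidError_le {s : ℂ} (hs : 0 < s.re) :
    ‖∑' n : ℕ, trapezoidError (n + 1) s‖ ≤ ‖s - 1‖ * ‖s‖ * ‖s + 1‖ / (8 * (s.re + 1)) := by
  have ht := (summable_trapezoidError hs).hasSum.tendsto_sum_nat.norm
  refine le_of_tendsto ht (Eventually.of_forall fun N => ?_)
  refine (norm_sum_le_of_le _ fun n _ =>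
    norm_trapezoidError_le (by positivity) (by linarith)).trans ?_
  rw [← Finset.mul_sum]
  refine mul_le_of_le_one_right (by positivity) ?_
  have := Finset.sum_range_sub' (fun n : ℕ => ((n : ℝ) + 1) ^ (-s.re - 1)) N
  push_cast at this
  rw [this]
  have := Real.rpow_nonneg (show (0 : ℝ) ≤ N + 1 by positivity) (-s.re - 1)
  simp only [zero_add, Real.one_rpow]
  linarith

theorem sum_range_trapezoidError (s : ℂ) (N : ℕ) :
    ∑ n ∈ Finset.range N, trapezoidError (n + 1) s =
      (s - 1) * (∑ n ∈ Finset.range N, 1 / ((n : ℂ) + 1) ^ s - 1 / 2 + ((N : ℂ) + 1) ^ (-s) / 2)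
        + ((N : ℂ) + 1) ^ (1 - s) - 1 := by
  induction N with
  | zero => simp
  | succ N ih =>
    rw [Finset.sum_range_succ, Finset.sum_range_succ, ih, trapezoidError, one_div (_ ^ s), ← cpow_neg]
    push_cast
    ring

theorem tendsto_natCast_add_one_cpow {z : ℂ} (hz : z.re < 0) :
    Tendsto (fun N : ℕ => ((N : ℂ) + 1) ^ z) atTop (𝓝 0) := by
  rw [tendsto_zero_iff_norm_tendsto_zero]
  have h := (tendsto_rpow_neg_atTop (neg_pos.2 hz)).comp
    (tendsto_atTop_add_const_right _ (1 : ℝ) tendsto_natCast_atTop_atTop)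
  refine h.congr fun N => ?_
  have := norm_cpow_eq_rpow_re_of_pos (show (0 : ℝ) < N + 1 by positivity) z
  push_cast at this
  simp [this]

theorem tsum_trapezoidError_of_one_lt_re {s : ℂ} (hs : 1 < s.re) :
    ∑' n : ℕ, trapezoidError (n + 1) s = (s - 1) * riemannZeta s - (s + 1) / 2 := by
  have hsum : Summable fun n : ℕ => 1 / ((n : ℂ) + 1) ^ s := by
    simpa using (summable_nat_add_iff 1).2 (Complex.summable_one_div_nat_cpow.2 hs)
  have hz := hsum.hasSum.tendsto_sum_nat
  rw [← zeta_eq_tsum_one_div_nat_add_one_cpow hs] at hz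
  have h1 := tendsto_natCast_add_one_cpow (z := -s) (by simp; linarith)
  have h2 := tendsto_natCast_add_one_cpow (z := 1 - s) (by simp; linarith)
  have ht := (((((hz.sub_const (1 / 2)).add (h1.div_const 2)).const_mul (s - 1)).add h2).sub_const
    1)
  refine tendsto_nhds_unique (summable_trapezoidError (by linarith)).hasSum.tendsto_sum_nat ?_
  convert ht using 2
  · exact sum_range_trapezoidError s _
  · ring

/-- The Euler–Maclaurin representation of `(s - 1) ζ(s)` in the right half-plane. -/
theorem riemannZeta₁_eq_add_tsum {s : ℂ} (hs : 0 < s.re) :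
    riemannZeta₁ s = (s + 1) / 2 + ∑' n : ℕ, trapezoidError (n + 1) s := by
  -- The half-plane is cut down to a half-disc containing `s` and `2`, on which the series is
  -- dominated; being convex, the half-disc is connected.
  let R : ℝ := ‖s‖ + 3
  let U : Set ℂ := {z | 0 < z.re} ∩ Metric.ball 0 R
  have hUo : IsOpen U := (isOpen_lt continuous_const continuous_re).inter Metric.isOpen_ball
  have hUc : IsPreconnected U :=
    ((convex_halfSpace_re_gt 0).inter (convex_ball 0 R)).isPreconnected
  have hsU : s ∈ U := ⟨hs, by simp [R]⟩
  have h2U : (2 : ℂ) ∈ U := ⟨by simp, by simp [R]; linarith [norm_nonneg s]⟩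
  have hd : DifferentiableOn ℂ (fun z => ∑' n : ℕ, trapezoidError (n + 1) z) U := by
    refine differentiableOn_tsum_of_summable_norm
      (summable_one_div_nat_add_one_sq.mul_left ((R + 1) * R * (R + 1) / 8))
      (fun n => (differentiable_trapezoidError (by positivity)).differentiableOn) hUo
      fun n z hz => (norm_trapezoidError_le_sq (by simp) hz.1).trans ?_
    have hzR : ‖z‖ ≤ R := by simpa using (mem_ball_zero_iff.1 hz.2).le
    have h1 : ‖z - 1‖ ≤ R + 1 := (norm_sub_le _ _).trans (by simpa using hzR)
    have h2 : ‖z + 1‖ ≤ R + 1 := (norm_add_le _ _).trans (by simpa using hzR)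
    gcongr
  have hf : AnalyticOnNhd ℂ riemannZeta₁ U :=
    differentiable_riemannZeta₁.differentiableOn.analyticOnNhd hUo
  have hg : AnalyticOnNhd ℂ (fun z => (z + 1) / 2 + ∑' n : ℕ, trapezoidError (n + 1) z) U :=
    (DifferentiableOn.add (by fun_prop) hd).analyticOnNhd hUo
  refine hf.eqOn_of_preconnected_of_eventuallyEq hg hUc h2U ?_ hsU
  filter_upwards [(isOpen_lt continuous_const continuous_re).mem_nhds
    (show (1 : ℝ) < (2 : ℂ).re by simp)] with z hz
  have hz1 : z ≠ 1 := by
    rintro rfl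
    simp at hz
  rw [tsum_trapezoidError_of_one_lt_re hz, riemannZeta_eq_inv_sub_mul hz1,
    mul_inv_cancel_left₀ (sub_ne_zero.2 hz1)]
  ring

/-! ### Zeros of the zeta function -/

theorem four_mul_re_add_one_le_of_riemannZeta_eq_zero {s : ℂ} (hs : 0 < s.re)
    (hz : riemannZeta s = 0) : 4 * (s.re + 1) ≤ ‖s‖ * ‖s - 1‖ := by
  have hs1 : s ≠ 1 := fun h => riemannZeta_one_ne_zero (h ▸ hz)
  have h0 : riemannZeta₁ s = 0 := by
    simpa [riemannZeta_eq_inv_sub_mul hs1, sub_ne_zero.2 hs1] using hz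
  rw [riemannZeta₁_eq_add_tsum hs] at h0
  have hb := norm_tsum_trapezoidError_le hs
  rw [← neg_eq_of_add_eq_zero_right h0, norm_neg, norm_div, Complex.norm_ofNat,
    le_div_iff₀ (by positivity)] at hb
  have hpos : 0 < ‖s + 1‖ := by
    rw [norm_pos_iff]
    intro h
    have := congrArg Complex.re h
    simp at this
    linarith
  refine le_of_mul_le_mul_right ?_ hpos
  linarith

theorem riemannZeta_one_sub_eq_zero {s : ℂ} (hs : 0 ≤ s.re) (hz : riemannZeta s = 0) :
    riemannZeta (1 - s) = 0 := by
  rw [riemannZeta_one_sub, hz, mul_zero]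
  · rintro n rfl
    have hn : n = 0 := by simpa using hs
    simp [hn, riemannZeta_zero] at hz
  · rintro rfl
    exact riemannZeta_one_ne_zero hz

theorem mainTheorem2 (s : ℂ) (hs : ‖s - 1‖ ≤ (2.2093 : ℝ)) (h0 : 0 ≤ s.re) (h1 : s.re ≤ 1) :
    riemannZeta s ≠ 0 := by
  intro hz
  have hprod : 4 * (max s.re (1 - s.re) + 1) ≤ ‖s‖ * ‖s - 1‖ := by
    rcases le_total (1 - s.re) s.re with h | h
    · rw [max_eq_left h]
      exact four_mul_re_add_one_le_of_riemannZeta_eq_zero (by linarith) hz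
    · rw [max_eq_right h]
      have := four_mul_re_add_one_le_of_riemannZeta_eq_zero (s := 1 - s) (by simp; linarith)
        (riemannZeta_one_sub_eq_zero h0 hz)
      rwa [show 1 - s - 1 = -s by ring, norm_neg, norm_sub_rev, mul_comm ‖s - 1‖, sub_re,
        one_re] at this
  have hmax : 1 / 2 ≤ max s.re (1 - s.re) := by
    rcases le_total (1 / 2) s.re with h | h
    · exact le_max_of_le_left h
    · exact le_max_of_le_right (by linarith)
  have hsq : ‖s‖ ^ 2 = ‖s - 1‖ ^ 2 + (2 * s.re - 1) := by
    simp only [Complex.sq_norm, normSq_apply, sub_re, sub_im, one_re, one_im]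
    ring
  -- `2.43 ^ 2` exceeds `2.2093 ^ 2 + 1`, and `2.43 * 2.2093 < 6`.
  have hn : ‖s‖ ≤ 2.43 := by nlinarith [norm_nonneg s, norm_nonneg (s - 1)]
  nlinarith [norm_nonneg s, norm_nonneg (s - 1), mul_le_mul hn hs (norm_nonneg _) (by norm_num)]
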